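/- Let $\mathcal G$ be an undirected connected graph on $N$ agents with adjacency matrix $(a_{ij})$, $a_{ij}\in\{0,1\}$. Let $\Omega\subset\mathbb R^p$ be convex and compact with nonempty interior, and let $\partial\Omega$ be a $C^2$ hypersurface with bounded normal curvature. Let $f_1,\dots,f_N:\Omega\to\mathbb R$ be differentiable such that, on $\Omega$, each gradient $\nabla f_i$ is $\sigma_i$-strongly monotone ($\langle x-y,\nabla f_i(x)-\nabla f_i(y)\rangle\ge\sigma_i\|x-y\|^2$) and $L_i$-Lipschitz, for some $\sigma_i,L_i>0$. Let $P_\Omega(x)=\operatorname{argmin}_{v\in\Omega}\|v-x\|^2$. For $k_1,k_2,\alpha,\beta>0$ consider the distributed algorithm $$\dot\eta_i=\beta k_1\sum_{j=1}^N a_{ij}(\eta_j-\eta_i)+\beta s_i-\beta\eta_i-\beta\alpha z_i,$$ $$\dot z_i=\frac{k_2}{\beta}\sum_{j=1}^N a_{ij}(z_j-z_i)+\frac{d}{dt}\nabla f_i(s_i),\qquad s_i=P_\Omega(\eta_i),$$ with $z_i(0)=\nabla f_i(s_i(0))$ and $\eta_i(0)\in\mathbb R^p$ arbitrary. A trajectory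 consists of locally absolutely continuous $\eta_i,z_i$ on $[0,\infty)$, with $s_i=P_\Omega(\eta_i)$ for all $t\ge 0$, that satisfy the differential equations for almost every $t\ge 0$. Then the problem $\min_{y\in\Omega}\sum_{i=1}^N f_i(y)$ has exactly one solution $y^*$, and for suitable parameters $s_i(t)$ converges exponentially to $y^*$. Precisely: there is $\alpha_0>0$ such that for every $\alpha\in(0,\alpha_0]$ there is $\kappa_1>0$ such that for every $k_1\ge\kappa_1$ there is $\kappa_2>0$ such that for all $k_2\ge\kappa_2$ and all $\beta\in(0,1]$ the following hold. For all initial values $\eta_i(0)$ a trajectory exists, and there is a rate $\gamma>0$ such that for every trajectory there is a constant $C$ with $$\|s_i(t)-y^*\|\le C e^{-\gamma t}\qquad\text{for all } i \text{ and all } t\ge 0 .$$ -/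

import Mathlib

open MeasureTheory Set

/-- `x` is a solution of the problem of minimizing `f` over `Ω`. -/
def IsConstrainedMin {p : ℕ} (f : EuclideanSpace ℝ (Fin p) → ℝ)
    (Ω : Set (EuclideanSpace ℝ (Fin p))) (x : EuclideanSpace ℝ (Fin p)) : Prop :=
  x ∈ Ω ∧ ∀ v ∈ Ω, f x ≤ f v

/-- `s` is the projection of `x` onto `Ω`, that is `s = argmin_{v ∈ Ω} ‖v - x‖ ^ 2`.
For nonempty closed convex `Ω` there is exactly one such `s`. -/
def IsProjection {p : ℕ} (Ω : Set (EuclideanSpace ℝ (Fin p)))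
    (x s : EuclideanSpace ℝ (Fin p)) : Prop :=
  IsConstrainedMin (fun v => ‖v - x‖ ^ 2) Ω s

/-- The boundary of `Ω` is a `C²` hypersurface (near each of its points `Ω` is the sublevel set
`φ ≤ 0` of a `C²` function that is regular on `φ = 0`), and all its normal curvatures are bounded
by one constant `M`. The normal curvature of `{φ = 0}` at `y` in the nonzero tangent direction `v`
is, up to sign, `D²φ(y)(v, v) / (‖∇φ(y)‖ ‖v‖²)`. -/
def HasBoundedNormalCurvature {p : ℕ} (Ω : Set (EuclideanSpace ℝ (Fin p))) : Prop :=
  ∃ M : ℝ, ∀ x ∈ frontier Ω, ∃ (U : Set (EuclideanSpace ℝ (Fin p)))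
    (φ : EuclideanSpace ℝ (Fin p) → ℝ),
    IsOpen U ∧ x ∈ U ∧ ContDiffOn ℝ 2 φ U ∧ (∀ y ∈ U, y ∈ Ω ↔ φ y ≤ 0) ∧
    ∀ y ∈ U, φ y = 0 → fderiv ℝ φ y ≠ 0 ∧
      ∀ v, fderiv ℝ φ y v = 0 →
        |fderiv ℝ (fderiv ℝ φ) y v v| ≤ M * ‖fderiv ℝ φ y‖ * ‖v‖ ^ 2

/-- `(η, z, s)` is a trajectory on `[0, ∞)` of the distributed projected algorithm
`η_i' = β k₁ ∑_j a_ij (η_j - η_i) + β s_i - β η_i - β α z_i`,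
`z_i' = (k₂ / β) ∑_j a_ij (z_j - z_i) + d/dt ∇f_i(s_i)`, `s_i = P_Ω(η_i)`,
started with `z_i(0) = ∇f_i(s_i(0))`. Since `P_Ω` and `∇f_i` are only Lipschitz, `η_i` and `z_i`
are locally absolutely continuous and the differential equations hold for almost every `t`.
Here `a_ij` is the adjacency matrix of the communication graph. -/
structure IsTrajectory {N p : ℕ} (G : SimpleGraph (Fin N)) [DecidableRel G.Adj]
    (Ω : Set (EuclideanSpace ℝ (Fin p))) (f : Fin N → EuclideanSpace ℝ (Fin p) → ℝ)
    (k₁ k₂ α β : ℝ) (η z s : Fin N → ℝ → EuclideanSpace ℝ (Fin p)) : Prop where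
  ac_eta : ∀ i, ∀ T : ℝ, 0 ≤ T → AbsolutelyContinuousOnInterval (η i) 0 T
  ac_z : ∀ i, ∀ T : ℝ, 0 ≤ T → AbsolutelyContinuousOnInterval (z i) 0 T
  proj : ∀ i, ∀ t : ℝ, 0 ≤ t → IsProjection Ω (η i t) (s i t)
  ode_eta : ∀ i, ∀ᵐ t ∂(volume.restrict (Ici (0 : ℝ))),
    HasDerivAt (η i)
      ((β * k₁) • ∑ j, G.adjMatrix ℝ i j • (η j t - η i t)
        + β • s i t - β • η i t - (β * α) • z i t) t
  ode_z : ∀ i, ∀ᵐ t ∂(volume.restrict (Ici (0 : ℝ))),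
    ∃ q, HasDerivAt (fun τ => gradientWithin (f i) Ω (s i τ)) q t ∧
      HasDerivAt (z i) ((k₂ / β) • ∑ j, G.adjMatrix ℝ i j • (z j t - z i t) + q) t
  init : ∀ i, z i 0 = gradientWithin (f i) Ω (s i 0)

/-! A minimizer `ystar` exists by compactness and is unique by strong monotonicity. With `zstar` the
average of the gradients at `ystar`, the optimality condition says that `ystar` is the projection of
`ηstar = ystar - α • zstar`, so all `η i = ηstar`, `z i = zstar` is the desired limit.

Since the coupling sums to zero, the average tracker always equals the average gradient
(`IsTrajectory.sum_tracker_eq`). In error coordinates the `η`-equation is then a contracting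
gradient step plus two defects: the disagreement of the `η i` and that of the `z i`. The Poincaré
inequality of the connected graph damps both, so `k₁` and then `k₂` can be chosen large enough to
absorb all cross terms. Hence `∑ ‖η i - ηstar‖² + ∑ ‖z i - zbar‖²` decays exponentially
(`lyapunov_dissipation`), and nonexpansiveness of the projection carries this to `s i`.

For existence, `z i` minus the gradient at `s i` turns the system into an autonomous globally
Lipschitz equation. -/

open scoped NNReal Topology RealInnerProductSpace

/-! ### Global solutions of Lipschitz differential equations -/

section ODE

variable {E : Type*} [NormedAddCommGroup E] [NormedSpace ℝ E]

/-- A curve on `[0, ∞)` glued from two solutions of an autonomous differential equation. -/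
theorem exists_solution_append {v : E → E} {x : E} {a b : ℝ} (ha : 0 ≤ a) (hb : 0 ≤ b)
    {γ₁ γ₂ : ℝ → E} (h₁ : γ₁ 0 = x)
    (d₁ : ∀ t ∈ Icc 0 a, HasDerivWithinAt γ₁ (v (γ₁ t)) (Icc 0 a) t) (h₂ : γ₂ 0 = γ₁ a)
    (d₂ : ∀ t ∈ Icc 0 b, HasDerivWithinAt γ₂ (v (γ₂ t)) (Icc 0 b) t) :
    ∃ γ : ℝ → E, γ 0 = x ∧
      ∀ t ∈ Icc 0 (a + b), HasDerivWithinAt γ (v (γ t)) (Icc 0 (a + b)) t := by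
  have hγ₁ : EqOn (fun t => if t ≤ a then γ₁ t else γ₂ (t - a)) γ₁ (Icc 0 a) := by
    intro t ht
    simp [ht.2]
  have hγ₂ : EqOn (fun t => if t ≤ a then γ₁ t else γ₂ (t - a)) (fun t => γ₂ (t - a))
      (Icc a (a + b)) := by
    intro t ht
    rcases ht.1.eq_or_lt with rfl | h
    · simp [h₂]
    · simp [h.not_ge]
  have e₂ : ∀ t ∈ Icc a (a + b),
      HasDerivWithinAt (fun t => γ₂ (t - a)) (v (γ₂ (t - a))) (Icc a (a + b)) t := by
    intro t ht
    have hm : MapsTo (fun t : ℝ => t - a) (Icc a (a + b)) (Icc 0 b) := fun s hs =>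
      ⟨by linarith [hs.1], by linarith [hs.2]⟩
    simpa [Function.comp_def] using (d₂ (t - a) (hm ht)).scomp t
      ((hasDerivAt_id t).sub_const a).hasDerivWithinAt hm
  refine ⟨fun t => if t ≤ a then γ₁ t else γ₂ (t - a), by simp [ha, h₁], fun t ht => ?_⟩
  have hun : Icc 0 (a + b) = Icc 0 a ∪ Icc a (a + b) :=
    (Icc_union_Icc_eq_Icc ha (by linarith)).symm
  have key₁ : t ≤ a → HasDerivWithinAt (fun t => if t ≤ a then γ₁ t else γ₂ (t - a))
      (v (if t ≤ a then γ₁ t else γ₂ (t - a))) (Icc 0 a) t := fun h => by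
    have hm : t ∈ Icc 0 a := ⟨ht.1, h⟩
    have := (d₁ t hm).congr_of_mem hγ₁ hm
    rwa [← hγ₁ hm] at this
  have key₂ : a ≤ t → HasDerivWithinAt (fun t => if t ≤ a then γ₁ t else γ₂ (t - a))
      (v (if t ≤ a then γ₁ t else γ₂ (t - a))) (Icc a (a + b)) t := fun h => by
    have hm : t ∈ Icc a (a + b) := ⟨h, ht.2⟩
    have := (e₂ t hm).congr_of_mem hγ₂ hm
    have h' := hγ₂ hm
    simp only at h'
    rwa [← h'] at this
  rw [hun]
  rcases lt_trichotomy t a with h | h | h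
  · refine (key₁ h.le).union ?_
    refine HasFDerivWithinAt.of_notMem_closure ?_
    rw [closure_Icc]
    exact fun hh => absurd hh.1 h.not_ge
  · exact (key₁ h.le).union (key₂ h.ge)
  · refine HasDerivWithinAt.union ?_ (key₂ h.le)
    refine HasFDerivWithinAt.of_notMem_closure ?_
    rw [closure_Icc]
    exact fun hh => absurd hh.2 h.not_ge

/-- An autonomous differential equation with globally Lipschitz right-hand side has a solution on
`[0, ∞)` for every initial value. -/
theorem LipschitzWith.exists_solution [CompleteSpace E] {v : E → E} {K : ℝ≥0}
    (hv : LipschitzWith K v) (x : E) :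
    ∃ γ : ℝ → E, γ 0 = x ∧ ∀ t ∈ Ici (0 : ℝ), HasDerivWithinAt γ (v (γ t)) (Ici 0) t := by
  -- On the ball of radius `‖v y‖` around `y` the field is at most `(1 + K) * ‖v y‖`, so
  -- Picard–Lindelöf gives the time span `1 / (1 + K)`, the same for every starting point.
  set h : ℝ := 1 / (1 + K) with hh
  have hK : (0 : ℝ) < 1 + K := by positivity
  have hpos : 0 < h := by positivity
  have step : ∀ y : E, ∃ γ : ℝ → E, γ 0 = y ∧
      ∀ t ∈ Icc 0 h, HasDerivWithinAt γ (v (γ t)) (Icc 0 h) t := by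
    intro y
    have := IsPicardLindelof.of_time_independent (f := v) (tmin := 0) (tmax := h)
      (t₀ := ⟨0, ⟨le_rfl, hpos.le⟩⟩) (x₀ := y) (a := ‖v y‖₊) (r := 0) (L := (1 + K) * ‖v y‖₊)
      (K := K) ?_ hv.lipschitzOnWith ?_
    · exact this.exists_eq_forall_mem_Icc_hasDerivWithinAt₀
    · intro z hz
      have h1 : ‖v z - v y‖ ≤ K * ‖v y‖ := by
        have := hv.dist_le_mul z y
        rw [dist_eq_norm] at this
        exact this.trans (mul_le_mul_of_nonneg_left (by simpa using hz) K.2)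
      have h2 : ‖v z‖ ≤ ‖v z - v y‖ + ‖v y‖ := by
        simpa using norm_add_le (v z - v y) (v y)
      push_cast
      linarith
    · simp only [sub_zero, sub_self, hh]
      push_cast
      apply le_of_eq
      rw [max_eq_left (by positivity)]
      field_simp
      simp
  have steps : ∀ n : ℕ, ∀ y : E, ∃ γ : ℝ → E, γ 0 = y ∧
      ∀ t ∈ Icc 0 (n * h), HasDerivWithinAt γ (v (γ t)) (Icc 0 (n * h)) t := by
    intro n
    induction n with
    | zero =>
      intro y
      refine ⟨fun _ => y, rfl, fun t ht => ?_⟩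
      exact HasFDerivWithinAt.of_subsingleton (by simp)
    | succ n ih =>
      intro y
      obtain ⟨γ₁, h₁, d₁⟩ := step y
      obtain ⟨γ₂, h₂, d₂⟩ := ih (γ₁ h)
      have := exists_solution_append hpos.le (by positivity) h₁ d₁ h₂ d₂
      rwa [show h + n * h = ((n + 1 : ℕ) : ℝ) * h by push_cast; ring] at this
  choose γ h0 hd using fun n => steps n x
  have uniq : ∀ m n : ℕ, ∀ t, 0 ≤ t → t ≤ m * h → t ≤ n * h → γ m t = γ n t := by
    have aux : ∀ m n : ℕ, m ≤ n → ∀ t, 0 ≤ t → t ≤ m * h → γ m t = γ n t := by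
      intro m n hmn t ht0 ht
      have hsub : Icc 0 (m * h) ⊆ Icc 0 (n * h) := Icc_subset_Icc_right (by gcongr)
      have hder : ∀ k : ℕ, ∀ t ∈ Ico 0 (k * h), HasDerivWithinAt (γ k) (v (γ k t)) (Ici t) t := by
        intro k t ht
        refine (hd k t ⟨ht.1, ht.2.le⟩).mono_of_mem_nhdsWithin ?_
        exact Filter.mem_of_superset (Icc_mem_nhdsGE ht.2) (Icc_subset_Icc_left ht.1)
      exact ODE_solution_unique_of_mem_Icc_right (v := fun _ => v) (s := fun _ => univ) (K := K)
        (fun t _ => hv.lipschitzOnWith)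
        (fun t ht => (hd m t ht).continuousWithinAt) (hder m) (fun _ _ => trivial)
        (fun t ht => ((hd n t (hsub ht)).mono hsub).continuousWithinAt)
        (fun t ht => hder n t ⟨ht.1, ht.2.trans_le (by gcongr)⟩) (fun _ _ => trivial)
        ((h0 m).trans (h0 n).symm) ⟨ht0, ht⟩
    intro m n t ht0 hm hn
    rcases le_total m n with hmn | hmn
    · exact aux m n hmn t ht0 hm
    · exact (aux n m hmn t ht0 hn).symm
  have hceil : ∀ t : ℝ, t ≤ (⌈t / h⌉₊ : ℝ) * h := fun t => by
    rw [← div_le_iff₀ hpos]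
    exact Nat.le_ceil _
  refine ⟨fun t => γ ⌈t / h⌉₊ t, h0 _, fun t ht => ?_⟩
  have ht0 : 0 ≤ t := ht
  -- The extra step puts `t` strictly before the right end `n * h`, so the derivative within the
  -- interval is one within `Ici 0`.
  set n := ⌈t / h⌉₊ + 1 with hn
  have htn : t < n * h := by
    have := hceil t
    rw [hn]; push_cast
    linarith
  have heq : EqOn (fun t => γ ⌈t / h⌉₊ t) (γ n) (Icc 0 (n * h)) := fun s hs =>
    uniq _ _ s hs.1 (hceil s) hs.2
  have hmem : t ∈ Icc 0 (n * h) := ⟨ht0, htn.le⟩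
  have h3 := (hd n t hmem).congr_of_mem heq hmem
  have h4 := heq hmem
  simp only at h4
  rw [← h4] at h3
  refine h3.mono_of_mem_nhdsWithin ?_
  rw [← Ici_inter_Iic]
  exact inter_mem_nhdsWithin _ (Iic_mem_nhds htn)

end ODE

/-! ### Absolutely continuous curves and differential inequalities -/

section AbsolutelyContinuous

theorem AbsolutelyContinuousOnInterval.of_dist_le {X Y : Type*} [PseudoMetricSpace X]
    [PseudoMetricSpace Y] {f : ℝ → X} {g : ℝ → Y} {a b C : ℝ}
    (hf : AbsolutelyContinuousOnInterval f a b)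
    (h : ∀ x ∈ uIcc a b, ∀ y ∈ uIcc a b, dist (g x) (g y) ≤ C * dist (f x) (f y)) :
    AbsolutelyContinuousOnInterval g a b := by
  unfold AbsolutelyContinuousOnInterval at hf ⊢
  refine squeeze_zero' (.of_forall fun _ => Finset.sum_nonneg fun _ _ => dist_nonneg) ?_
    (by simpa using hf.const_mul C)
  rw [Filter.eventually_inf_principal]
  refine .of_forall fun I hI => ?_
  rw [Finset.mul_sum]
  exact Finset.sum_le_sum fun i hi => h _ (hI.1 i hi).1 _ (hI.1 i hi).2

theorem AbsolutelyContinuousOnInterval.norm_sq {F : Type*} [NormedAddCommGroup F]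
    {f : ℝ → F} {a b : ℝ} (hf : AbsolutelyContinuousOnInterval f a b) :
    AbsolutelyContinuousOnInterval (fun t => ‖f t‖ ^ 2) a b := by
  have h : AbsolutelyContinuousOnInterval (fun t => ‖f t‖) a b :=
    hf.of_dist_le (C := 1) fun x _ y _ => by
      rw [one_mul, Real.dist_eq, dist_eq_norm]
      exact abs_norm_sub_norm_le _ _
  simpa only [pow_two] using h.fun_mul h

theorem AbsolutelyContinuousOnInterval.const {X : Type*} [PseudoMetricSpace X] (c : X) (a b : ℝ) :
    AbsolutelyContinuousOnInterval (fun _ => c) a b :=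
  (LipschitzWith.const (α := ℝ) c).lipschitzOnWith.absolutelyContinuousOnInterval

theorem AbsolutelyContinuousOnInterval.fun_sum {ι F : Type*} [NormedAddCommGroup F]
    [NormedSpace ℝ F] {f : ι → ℝ → F} {a b : ℝ} (s : Finset ι)
    (hf : ∀ i ∈ s, AbsolutelyContinuousOnInterval (f i) a b) :
    AbsolutelyContinuousOnInterval (fun t => ∑ i ∈ s, f i t) a b := by
  classical
  induction s using Finset.induction_on with
  | empty => simpa using AbsolutelyContinuousOnInterval.const (0 : F) a b
  | insert i s hi ih =>
    simp only [Finset.sum_insert hi]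
    exact (hf i (Finset.mem_insert_self _ _)).fun_add
      (ih fun j hj => hf j (Finset.mem_insert_of_mem hj))

/-- Exponential decay from an almost everywhere differential inequality. -/
theorem le_mul_exp_of_ae_hasDerivAt_le {V : ℝ → ℝ} {c : ℝ}
    (hac : ∀ T, 0 ≤ T → AbsolutelyContinuousOnInterval V 0 T)
    (hV : ∀ᵐ t ∂(volume.restrict (Ici (0 : ℝ))), ∃ d, HasDerivAt V d t ∧ d ≤ -c * V t)
    {t : ℝ} (ht : 0 ≤ t) : V t ≤ V 0 * Real.exp (-c * t) := by
  -- The product of `V` with this factor has nonpositive derivative almost everywhere, and absolute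
  -- continuity permits integrating it.
  have hexp : AbsolutelyContinuousOnInterval (fun t => Real.exp (c * t)) 0 t :=
    ContDiffOn.absolutelyContinuousOnInterval (by fun_prop)
  have hW := ((hac t ht).fun_mul hexp).integral_deriv_eq_sub
  have hle : ∫ x in (0 : ℝ)..t, deriv (fun x => V x * Real.exp (c * x)) x ≤ 0 := by
    rw [intervalIntegral.integral_of_le ht]
    refine integral_nonpos_of_ae ?_
    have hsub : volume.restrict (Ioc 0 t) ≤ volume.restrict (Ici (0 : ℝ)) :=
      Measure.restrict_mono (fun x hx => hx.1.le) le_rfl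
    filter_upwards [hsub.absolutelyContinuous.ae_le hV] with x hx
    obtain ⟨d, hd, hdle⟩ := hx
    have he : HasDerivAt (fun x => Real.exp (c * x)) (Real.exp (c * x) * (c * 1)) x :=
      ((hasDerivAt_id x).const_mul c).exp
    rw [(hd.fun_mul he).deriv]
    have := Real.exp_pos (c * x)
    simp only [Pi.zero_apply]
    nlinarith
  rw [hW] at hle
  simp only [mul_zero, Real.exp_zero, mul_one] at hle
  rw [neg_mul, Real.exp_neg, ← div_eq_mul_inv, le_div_iff₀ (Real.exp_pos _)]
  linarith

/-- Replaces the chain rule where `g` depends on `f` through a merely Lipschitz map: difference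
quotients are compared. -/
theorem HasDerivAt.norm_le_of_dist_le {E F : Type*} [NormedAddCommGroup E] [NormedSpace ℝ E]
    [NormedAddCommGroup F] [NormedSpace ℝ F] {f : ℝ → E} {g : ℝ → F} {f' : E} {g' : F} {t C : ℝ}
    (hf : HasDerivAt f f' t) (hg : HasDerivAt g g' t)
    (h : ∀ᶠ x in 𝓝 t, ‖g x - g t‖ ≤ C * ‖f x - f t‖) : ‖g'‖ ≤ C * ‖f'‖ := by
  refine le_of_tendsto_of_tendsto hg.tendsto_slope.norm (hf.tendsto_slope.norm.const_mul C) ?_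
  filter_upwards [nhdsWithin_le_nhds h] with x hx
  simp only [slope_def_module, norm_smul]
  nlinarith [norm_nonneg ((x - t)⁻¹)]

end AbsolutelyContinuous

/-! ### Projection onto a convex set and first-order optimality -/

section Projection

variable {p : ℕ} {Ω : Set (EuclideanSpace ℝ (Fin p))}

theorem isProjection_iff_inner_le (hΩ : Convex ℝ Ω) {x s : EuclideanSpace ℝ (Fin p)} :
    IsProjection Ω x s ↔ s ∈ Ω ∧ ∀ w ∈ Ω, ⟪x - s, w - s⟫ ≤ 0 := by
  unfold IsProjection IsConstrainedMin
  refine and_congr_right fun hs => ?_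
  rw [← norm_eq_iInf_iff_real_inner_le_zero hΩ hs]
  have : Nonempty Ω := ⟨⟨s, hs⟩⟩
  have hbdd : BddBelow (range fun w : Ω => ‖x - w‖) :=
    ⟨0, forall_mem_range.2 fun _ => norm_nonneg _⟩
  constructor
  · intro h
    refine le_antisymm (le_ciInf fun w => ?_) (ciInf_le hbdd ⟨s, hs⟩)
    rw [norm_sub_rev x s, norm_sub_rev x w]
    exact le_of_sq_le_sq (h w w.2) (norm_nonneg _)
  · intro h v hv
    have : ‖x - s‖ ≤ ‖x - v‖ := h.trans_le (ciInf_le hbdd ⟨v, hv⟩)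
    rw [norm_sub_rev x s, norm_sub_rev x v] at this
    exact pow_le_pow_left₀ (norm_nonneg _) this 2

theorem exists_isProjection (hΩ : IsCompact Ω) (hne : Ω.Nonempty)
    (x : EuclideanSpace ℝ (Fin p)) : ∃ s, IsProjection Ω x s := by
  obtain ⟨s, hs, h⟩ := hΩ.exists_isMinOn hne
    (f := fun v => ‖v - x‖ ^ 2) (by fun_prop)
  exact ⟨s, hs, fun v hv => h hv⟩

/-- Add the variational inequalities of the two projections, each tested at the other one, and apply
Cauchy–Schwarz. -/
theorem IsProjection.norm_sub_le (hΩ : Convex ℝ Ω) {x y s r : EuclideanSpace ℝ (Fin p)}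
    (hs : IsProjection Ω x s) (hr : IsProjection Ω y r) : ‖s - r‖ ≤ ‖x - y‖ := by
  rw [isProjection_iff_inner_le hΩ] at hs hr
  have h1 := hs.2 r hr.1
  have h2 := hr.2 s hs.1
  have h3 : ⟪x - y, s - r⟫ - ⟪s - r, s - r⟫ =
      -(⟪x - s, r - s⟫ + ⟪y - r, s - r⟫) := by
    simp only [inner_sub_left, inner_sub_right]
    ring
  have h4 := real_inner_le_norm (x - y) (s - r)
  rw [real_inner_self_eq_norm_sq] at h3
  rcases (norm_nonneg (s - r)).eq_or_lt with h | h
  · rw [← h]; exact norm_nonneg _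
  · refine le_of_mul_le_mul_right ?_ h
    nlinarith

/-- First-order necessary condition for a minimum over a convex set. -/
theorem IsConstrainedMin.inner_gradientWithin_nonneg (hΩ : Convex ℝ Ω)
    {f : EuclideanSpace ℝ (Fin p) → ℝ} {g x : EuclideanSpace ℝ (Fin p)}
    (h : IsConstrainedMin f Ω x) (hf : HasGradientWithinAt f g Ω x)
    {v : EuclideanSpace ℝ (Fin p)} (hv : v ∈ Ω) : 0 ≤ ⟪g, v - x⟫ := by
  have hmin : IsLocalMinOn f Ω x := IsMinOn.localize fun v hv => h.2 v hv
  simpa using hmin.hasFDerivWithinAt_nonneg hf.hasFDerivWithinAt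
    (sub_mem_posTangentConeAt_of_segment_subset (hΩ.segment_subset h.1 hv))

end Projection

/-! ### Edge energy and the Poincaré inequality on a graph -/

section Sums

variable {ι : Type*} [Fintype ι] {F : Type*} [NormedAddCommGroup F]

/-- A walk bounds the distance of the values at its ends by the edge energy. -/
theorem SimpleGraph.Walk.norm_sub_le {V : Type*} {G : SimpleGraph V} {x : V → F} {e : ℝ}
    (h : ∀ i j, G.Adj i j → ‖x i - x j‖ ≤ e) {i j : V} (w : G.Walk i j) :
    ‖x i - x j‖ ≤ w.length * e := by
  induction w with
  | nil => simp
  | cons hadj w ih =>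
    have := norm_sub_le_norm_sub_add_norm_sub (x _) (x _) (x _) |>.trans
      (add_le_add (h _ _ hadj) ih)
    simp only [SimpleGraph.Walk.length_cons]
    push_cast
    linarith

variable [InnerProductSpace ℝ F]

/-- Average the sum with its copy under the swap of `i` and `j`, which the symmetric adjacency
matrix allows. -/
theorem sum_adjMatrix_inner {G : SimpleGraph ι} [DecidableRel G.Adj] (x : ι → F) :
    ∑ i, ⟪x i, ∑ j, G.adjMatrix ℝ i j • (x j - x i)⟫ =
      -(1 / 2) * ∑ i, ∑ j, G.adjMatrix ℝ i j * ‖x i - x j‖ ^ 2 := by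
  have h1 : ∑ i, ⟪x i, ∑ j, G.adjMatrix ℝ i j • (x j - x i)⟫ =
      ∑ i, ∑ j, G.adjMatrix ℝ i j * ⟪x i, x j - x i⟫ := by
    simp only [inner_sum, inner_smul_right]
  have h2 : ∑ i, ⟪x i, ∑ j, G.adjMatrix ℝ i j • (x j - x i)⟫ =
      ∑ i, ∑ j, G.adjMatrix ℝ i j * ⟪x j, x i - x j⟫ := by
    rw [h1, Finset.sum_comm]
    simp only [G.adjMatrix_apply, G.adj_comm]
  have h3 : ∀ i j, G.adjMatrix ℝ i j * ‖x i - x j‖ ^ 2 =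
      -(G.adjMatrix ℝ i j * ⟪x i, x j - x i⟫) - G.adjMatrix ℝ i j * ⟪x j, x i - x j⟫ := by
    intro i j
    rw [← real_inner_self_eq_norm_sq]
    simp only [inner_sub_left, inner_sub_right, real_inner_comm (x i) (x j)]
    ring
  simp only [h3, Finset.sum_sub_distrib, Finset.sum_neg_distrib, ← h1, ← h2]
  ring

/-- Poincaré inequality on a connected graph. -/
theorem SimpleGraph.Connected.exists_poincare {G : SimpleGraph ι} [DecidableRel G.Adj]
    (hG : G.Connected) : ∃ c > (0 : ℝ), ∀ x : ι → F,
      c * ∑ i, ‖x i - (Fintype.card ι : ℝ)⁻¹ • ∑ j, x j‖ ^ 2 ≤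
        -∑ i, ⟪x i, ∑ j, G.adjMatrix ℝ i j • (x j - x i)⟫ := by
  have := hG.nonempty
  set N : ℝ := (Fintype.card ι : ℝ) with hN
  have hNpos : 0 < N := by rw [hN]; exact_mod_cast Fintype.card_pos
  obtain ⟨D, hD⟩ : ∃ D : ℕ, ∀ i j : ι, ∃ w : G.Walk i j, w.length ≤ D := by
    choose w _ using fun i j => ((hG i j).exists_isPath)
    exact ⟨∑ i, ∑ j, (w i j).length, fun i j => ⟨w i j,
      (Finset.single_le_sum (f := fun j => (w i j).length) (fun _ _ => Nat.zero_le _)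
        (Finset.mem_univ j)).trans
      (Finset.single_le_sum (f := fun i => ∑ j, (w i j).length) (fun _ _ => Nat.zero_le _)
        (Finset.mem_univ i))⟩⟩
  -- Walks of length at most `D` bound each deviation from the mean by `D * √e`. The 2 comes from
  -- the half in the edge energy; `D + 1` avoids division by zero when `D = 0`.
  refine ⟨1 / (2 * N * (D + 1) ^ 2), by positivity, fun x => ?_⟩
  rw [sum_adjMatrix_inner]
  set e := ∑ i, ∑ j, G.adjMatrix ℝ i j * ‖x i - x j‖ ^ 2 with he
  have hnn : ∀ i j, 0 ≤ G.adjMatrix ℝ i j * ‖x i - x j‖ ^ 2 := fun i j => by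
    rw [G.adjMatrix_apply]; split_ifs <;> positivity
  have he0 : 0 ≤ e := Finset.sum_nonneg fun i _ => Finset.sum_nonneg fun j _ => hnn i j
  have hedge : ∀ i j, G.Adj i j → ‖x i - x j‖ ≤ √e := by
    intro i j hij
    refine Real.le_sqrt_of_sq_le ?_
    have h1 := (Finset.single_le_sum (fun j _ => hnn i j) (Finset.mem_univ j)).trans
      (Finset.single_le_sum (f := fun i => ∑ j, G.adjMatrix ℝ i j * ‖x i - x j‖ ^ 2)
        (fun i _ => Finset.sum_nonneg fun j _ => hnn i j) (Finset.mem_univ i))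
    have h2 : G.adjMatrix ℝ i j = 1 := by simp [hij]
    beta_reduce at h1
    rwa [h2, one_mul] at h1
  have hdist : ∀ i j, ‖x i - x j‖ ≤ D * √e := by
    intro i j
    obtain ⟨w, hw⟩ := hD i j
    refine (w.norm_sub_le hedge).trans ?_
    gcongr
  have hmean : ∀ i, ‖x i - N⁻¹ • ∑ j, x j‖ ≤ D * √e := by
    intro i
    have : x i - N⁻¹ • ∑ j, x j = N⁻¹ • ∑ j, (x i - x j) := by
      rw [Finset.sum_sub_distrib, smul_sub, Finset.sum_const, Finset.card_univ,
        ← Nat.cast_smul_eq_nsmul ℝ, smul_smul, inv_mul_cancel₀ hNpos.ne', one_smul]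
    rw [this, norm_smul, Real.norm_of_nonneg (by positivity), inv_mul_le_iff₀ hNpos]
    refine (norm_sum_le_of_le _ fun j _ => hdist i j).trans ?_
    simp [hN]
  have hsum : ∑ i, ‖x i - N⁻¹ • ∑ j, x j‖ ^ 2 ≤ N * ((D + 1) ^ 2 * e) := by
    have : ∀ i ∈ Finset.univ, ‖x i - N⁻¹ • ∑ j, x j‖ ^ 2 ≤ ((D : ℝ) + 1) ^ 2 * e := by
      intro i _
      calc _ ≤ (D * √e) ^ 2 := pow_le_pow_left₀ (norm_nonneg _) (hmean i) 2
        _ = (D : ℝ) ^ 2 * e := by rw [mul_pow, Real.sq_sqrt he0]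
        _ ≤ _ := by gcongr; linarith
    refine (Finset.sum_le_sum this).trans ?_
    simp [hN]
  calc _ ≤ 1 / (2 * N * (D + 1) ^ 2) * (N * ((D + 1) ^ 2 * e)) := by gcongr
    _ = _ := by field_simp

end Sums

/-! ### Stacked states, averaging and diffusion -/

section Stacked

variable {ι : Type*} [Fintype ι] {F : Type*} [NormedAddCommGroup F]

theorem PiLp.norm_le_mul_norm {a b : PiLp 2 (fun _ : ι => F)} {C : ℝ} (hC : 0 ≤ C)
    (h : ∀ i, ‖a i‖ ≤ C * ‖b i‖) : ‖a‖ ≤ C * ‖b‖ := by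
  refine le_of_sq_le_sq ?_ (by positivity)
  rw [mul_pow, PiLp.norm_sq_eq_of_L2, PiLp.norm_sq_eq_of_L2, Finset.mul_sum]
  refine Finset.sum_le_sum fun i _ => ?_
  rw [← mul_pow]
  exact pow_le_pow_left₀ (norm_nonneg _) (h i) 2

variable [InnerProductSpace ℝ F]

/-- The average of the components of `x`, repeated in every component. -/
noncomputable def consensusPart (x : PiLp 2 (fun _ : ι => F)) : PiLp 2 (fun _ : ι => F) :=
  WithLp.toLp 2 fun _ => (Fintype.card ι : ℝ)⁻¹ • ∑ j, x j

theorem inner_consensusPart (x y : PiLp 2 (fun _ : ι => F)) :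
    ⟪x, consensusPart y⟫ = ⟪consensusPart x, y⟫ := by
  simp only [PiLp.inner_apply, consensusPart, inner_smul_left, inner_smul_right, ← Finset.mul_sum,
    ← sum_inner, ← inner_sum]
  simp

theorem consensusPart_const [Nonempty ι] (c : F) :
    consensusPart (WithLp.toLp 2 fun _ : ι => c) = WithLp.toLp 2 fun _ => c := by
  ext i
  have : (Fintype.card ι : ℝ) ≠ 0 := by exact_mod_cast Fintype.card_ne_zero
  simp [consensusPart, ← Nat.cast_smul_eq_nsmul ℝ, smul_smul, this]

/-- Averaging is self-adjoint and idempotent, hence an orthogonal projection. -/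
theorem norm_consensusPart_le [Nonempty ι] (x : PiLp 2 (fun _ : ι => F)) :
    ‖consensusPart x‖ ≤ ‖x‖ := by
  have h1 : ‖consensusPart x‖ ^ 2 = ⟪x, consensusPart x⟫ := by
    rw [← real_inner_self_eq_norm_sq, ← inner_consensusPart x (consensusPart x)]
    rw [show consensusPart (consensusPart x) = consensusPart x from consensusPart_const _]
  have h2 := real_inner_le_norm x (consensusPart x)
  rcases (norm_nonneg (consensusPart x)).eq_or_lt with h | h
  · rw [← h]; exact norm_nonneg _
  · exact le_of_mul_le_mul_right (by nlinarith) h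

/-- The diffusive coupling `x ↦ (∑ j, a_ij (x_j - x_i))_i` along the edges of a graph. -/
noncomputable def diffusion [FiniteDimensional ℝ F] (G : SimpleGraph ι) [DecidableRel G.Adj] :
    PiLp 2 (fun _ : ι => F) →L[ℝ] PiLp 2 (fun _ : ι => F) :=
  LinearMap.toContinuousLinearMap
    { toFun := fun x => WithLp.toLp 2 fun i => ∑ j, G.adjMatrix ℝ i j • (x j - x i)
      map_add' := fun x y => by
        ext i
        simp only [PiLp.add_apply, ← Finset.sum_add_distrib, ← smul_add]
        exact Finset.sum_congr rfl fun j _ => by congr 1; abel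
      map_smul' := fun c x => by
        ext i
        simp only [PiLp.smul_apply, RingHom.id_apply, Finset.smul_sum]
        exact Finset.sum_congr rfl fun j _ => by rw [← smul_sub, smul_comm] }

@[simp]
theorem diffusion_apply [FiniteDimensional ℝ F] (G : SimpleGraph ι) [DecidableRel G.Adj]
    (x : PiLp 2 (fun _ : ι => F)) (i : ι) :
    diffusion G x i = ∑ j, G.adjMatrix ℝ i j • (x j - x i) := rfl

theorem sum_diffusion_eq_zero (G : SimpleGraph ι) [DecidableRel G.Adj] (x : ι → F) :
    ∑ i, ∑ j, G.adjMatrix ℝ i j • (x j - x i) = 0 := by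
  simp only [smul_sub, Finset.sum_sub_distrib, sub_eq_zero]
  rw [Finset.sum_comm]
  simp only [G.adjMatrix_apply, G.adj_comm]

theorem SimpleGraph.Connected.exists_inner_diffusion_le [FiniteDimensional ℝ F]
    {G : SimpleGraph ι} [DecidableRel G.Adj] (hG : G.Connected) :
    ∃ c > (0 : ℝ), ∀ x : PiLp 2 (fun _ : ι => F),
      ⟪x, diffusion G x⟫ ≤ -(c * ‖x - consensusPart x‖ ^ 2) := by
  obtain ⟨c, hc, h⟩ := hG.exists_poincare (F := F)
  refine ⟨c, hc, fun x => ?_⟩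
  have := h x
  rw [PiLp.norm_sq_eq_of_L2, PiLp.inner_apply]
  simp only [PiLp.sub_apply, consensusPart, diffusion_apply]
  linarith

end Stacked

/-! ### The dissipation inequality -/

section Lyapunov

variable {H : Type*} [NormedAddCommGroup H] [InnerProductSpace ℝ H]

/-- Expanding the square gives the factor `1 - 2ασ + α²L² ≤ 1 - ασ ≤ (1 - ασ/2)²`. -/
theorem norm_sub_smul_le_of_strongly_monotone {u m : H} {α σ L : ℝ} (hα : 0 < α)
    (hαL : α * L ^ 2 ≤ σ) (hασ : α * σ ≤ 1) (hm : ‖m‖ ≤ L * ‖u‖)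
    (hmono : σ * ‖u‖ ^ 2 ≤ ⟪u, m⟫) : ‖u - α • m‖ ≤ (1 - α * σ / 2) * ‖u‖ := by
  refine le_of_sq_le_sq ?_ (mul_nonneg (by linarith) (norm_nonneg _))
  rw [norm_sub_sq_real, inner_smul_right, norm_smul, Real.norm_of_nonneg hα.le]
  have h1 : ‖m‖ ^ 2 ≤ L ^ 2 * ‖u‖ ^ 2 := by
    rw [← mul_pow]; exact pow_le_pow_left₀ (norm_nonneg _) hm 2
  have h2 : α ^ 2 * ‖m‖ ^ 2 ≤ α * σ * ‖u‖ ^ 2 := by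
    calc _ ≤ α ^ 2 * (L ^ 2 * ‖u‖ ^ 2) := by gcongr
      _ = α * (α * L ^ 2) * ‖u‖ ^ 2 := by ring
      _ ≤ _ := by gcongr
  have h3 := mul_le_mul_of_nonneg_left hmono hα.le
  have h4 : 0 ≤ (α * σ / 2) ^ 2 * ‖u‖ ^ 2 := by positivity
  nlinarith

/-- Young's inequality: each of the cross terms in `a * X` and `X * B` spends `α * σ / 8` of the
available `α * σ / 2` on `X ^ 2`; `P` and `Q` pay for the rest. -/
theorem quadratic_form_le {α σ L K a X B P Q : ℝ} (hα : 0 < α) (hσ : 0 < σ)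
    (hP : 2 * α * L ^ 2 / σ ≤ P)
    (hQ : 2 * (α + L * K) ^ 2 / (α * σ) + α * L + α * σ / 8 ≤ Q) :
    -(P * a ^ 2) - α * σ / 2 * X ^ 2 + α * L * (a * X) + α * (X * B) +
      -(Q * B ^ 2) + (L * K * (X * B) + α * L * B ^ 2) ≤
      -(α * σ / 8) * (X ^ 2 + B ^ 2) := by
  have y1 : α * L * (a * X) ≤ α * σ / 8 * X ^ 2 + 2 * α * L ^ 2 / σ * a ^ 2 := by
    have : 0 ≤ α * (σ * X - 4 * L * a) ^ 2 / (8 * σ) := by positivity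
    have h : α * (σ * X - 4 * L * a) ^ 2 / (8 * σ) =
        α * σ / 8 * X ^ 2 + 2 * α * L ^ 2 / σ * a ^ 2 - α * L * (a * X) := by
      field_simp; ring
    linarith
  have y2 : (α + L * K) * (X * B) ≤ α * σ / 8 * X ^ 2 +
      2 * (α + L * K) ^ 2 / (α * σ) * B ^ 2 := by
    generalize α + L * K = D
    have : 0 ≤ (α * σ * X - 4 * D * B) ^ 2 / (8 * (α * σ)) := by positivity
    have h : (α * σ * X - 4 * D * B) ^ 2 / (8 * (α * σ)) =
        α * σ / 8 * X ^ 2 + 2 * D ^ 2 / (α * σ) * B ^ 2 - D * (X * B) := by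
      field_simp; ring
    linarith
  have y3 := mul_le_mul_of_nonneg_right hQ (sq_nonneg B)
  have y4 := mul_le_mul_of_nonneg_right hP (sq_nonneg a)
  have y5 : 0 ≤ α * σ * X ^ 2 := by positivity
  linarith

/-- The dissipation inequality of the closed loop in error coordinates: `x` is the error of the
auxiliary states, `y` its disagreement, `b` the disagreement of the gradient trackers, `u` and `m`
the errors of the projected states and of their gradients, and `n` the average of `m`. -/
theorem lyapunov_dissipation {x y u m n b Ax Ab x' q : H} {α β σ L c Λ k₁ k₂ : ℝ}
    (hα : 0 < α) (hβ : 0 < β) (hβ1 : β ≤ 1) (hσ : 0 < σ) (hL : 0 < L) (hc : 0 < c) (hΛ : 0 ≤ Λ)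
    (hαL : α * L ^ 2 ≤ σ) (hασ : α * σ ≤ 1)
    (hk₁ : 2 * α * L ^ 2 / σ ≤ k₁ * c)
    (hk₂ : 2 * (α + L * (k₁ * Λ + 2 + α * L)) ^ 2 / (α * σ) + α * L + α * σ / 8 ≤ k₂ * c)
    (hAx : ⟪x, Ax⟫ ≤ -(c * ‖y‖ ^ 2)) (hAb : ⟪b, Ab⟫ ≤ -(c * ‖b‖ ^ 2)) (hAn : ‖Ax‖ ≤ Λ * ‖x‖)
    (hu : ‖u‖ ≤ ‖x‖) (hm : ‖m‖ ≤ L * ‖u‖) (hmono : σ * ‖u‖ ^ 2 ≤ ⟪u, m⟫)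
    (hn : ‖n‖ ≤ ‖m‖) (hxn : ⟪x, n⟫ = ⟪x, m⟫ - ⟪y, m⟫)
    (hx' : x' = (β * k₁) • Ax + β • u - β • x - (β * α) • (b + n)) (hq : ‖q‖ ≤ L * ‖x'‖) :
    2 * ⟪x, x'⟫ + 2 * ⟪b, (k₂ / β) • Ab + q⟫ ≤
      -(β * α * σ / 4) * (‖x‖ ^ 2 + ‖b‖ ^ 2) := by
  have hk₁0 : 0 ≤ k₁ := nonneg_of_mul_nonneg_left (le_trans (by positivity) hk₁) hc
  have hk₂0 : 0 ≤ k₂ := nonneg_of_mul_nonneg_left (le_trans (by positivity) hk₂) hc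
  have hmx : ‖m‖ ≤ L * ‖x‖ := hm.trans (by gcongr)
  set X := ‖x‖
  set B := ‖b‖
  set a := ‖y‖
  have hX : 0 ≤ X := norm_nonneg _
  have hB : 0 ≤ B := norm_nonneg _
  have ha : 0 ≤ a := norm_nonneg _
  -- With the damping `-X ^ 2` in `e4`, the contraction leaves a net `-(α * σ / 2) * X ^ 2`.
  have e1 : ⟪x, u - α • m⟫ ≤ (1 - α * σ / 2) * X ^ 2 := by
    calc _ ≤ X * ‖u - α • m‖ := real_inner_le_norm _ _
      _ ≤ X * ((1 - α * σ / 2) * X) := by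
        gcongr
        exact (norm_sub_smul_le_of_strongly_monotone hα hαL hασ hm hmono).trans
          (mul_le_mul_of_nonneg_left hu (by linarith))
      _ = _ := by ring
  have e2 : ⟪y, m⟫ ≤ a * (L * X) := (real_inner_le_norm _ _).trans (by gcongr)
  have e3 : -⟪x, b⟫ ≤ X * B := (abs_le.1 (abs_real_inner_le_norm x b)).1 |> fun h => by linarith
  have e4 : ⟪x, x'⟫ = β * (k₁ * ⟪x, Ax⟫ + ⟪x, u - α • m⟫ + α * ⟪y, m⟫ - X ^ 2 - α * ⟪x, b⟫) := by
    rw [hx']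
    simp only [inner_add_right, inner_sub_right, inner_smul_right, hxn,
      real_inner_self_eq_norm_sq]
    ring
  have e5 : ⟪x, x'⟫ ≤ β * (-(k₁ * c * a ^ 2) - α * σ / 2 * X ^ 2 + α * L * (a * X) +
      α * (X * B)) := by
    rw [e4]
    refine mul_le_mul_of_nonneg_left ?_ hβ.le
    have := mul_le_mul_of_nonneg_left hAx hk₁0
    have := mul_le_mul_of_nonneg_left e2 hα.le
    have := mul_le_mul_of_nonneg_left e3 hα.le
    linarith
  -- Collects the coefficients of `X` in `‖x'‖ / β`: coupling, the terms `u` and `x`, and the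
  -- averaged gradient error.
  set K := k₁ * Λ + 2 + α * L with hK
  have e6 : ‖x'‖ ≤ β * (K * X + α * B) := by
    rw [hx']
    have h1 : ‖(β * k₁) • Ax‖ ≤ β * k₁ * (Λ * X) := by
      rw [norm_smul, Real.norm_of_nonneg (by positivity)]; gcongr
    have h2 : ‖β • u‖ ≤ β * X := by
      rw [norm_smul, Real.norm_of_nonneg hβ.le]; gcongr
    have h3 : ‖β • x‖ = β * X := by rw [norm_smul, Real.norm_of_nonneg hβ.le]
    have h4 : ‖(β * α) • (b + n)‖ ≤ β * α * (B + L * X) := by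
      rw [norm_smul, Real.norm_of_nonneg (by positivity)]
      gcongr
      exact (norm_add_le _ _).trans (by gcongr; exact hn.trans hmx)
    have h5 := norm_sub_le ((β * k₁) • Ax + β • u - β • x) ((β * α) • (b + n))
    have h6 := norm_sub_le ((β * k₁) • Ax + β • u) (β • x)
    have h7 := norm_add_le ((β * k₁) • Ax) (β • u)
    rw [hK]
    linarith
  have e7 : ⟪b, q⟫ ≤ β * (L * K * (X * B) + α * L * B ^ 2) := by
    calc _ ≤ B * ‖q‖ := real_inner_le_norm _ _
      _ ≤ B * (L * (β * (K * X + α * B))) := by gcongr; exact hq.trans (by gcongr)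
      _ = _ := by ring
  have e8 : (k₂ / β) * ⟪b, Ab⟫ ≤ β * (-(k₂ * c * B ^ 2)) := by
    -- This is where `β ≤ 1` enters; it puts the tracker damping on the common scale `β`.
    have h1 : β * k₂ ≤ k₂ / β := by
      rw [le_div_iff₀ hβ]
      nlinarith [mul_nonneg hk₂0 hβ.le]
    have h2 := mul_le_mul_of_nonneg_left hAb (div_nonneg hk₂0 hβ.le)
    have h3 : β * k₂ * (c * B ^ 2) ≤ k₂ / β * (c * B ^ 2) := by gcongr
    linarith
  have total := quadratic_form_le (a := a) (X := X) (B := B) (K := K) hα hσ hk₁ hk₂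
  rw [inner_add_right, inner_smul_right]
  have := mul_le_mul_of_nonneg_left total hβ.le
  linarith

end Lyapunov

/-! ### Existence and decay of trajectories -/

section Trajectory

theorem ae_differentiableAt_of_absolutelyContinuousOnInterval {F : Type*} [NormedAddCommGroup F]
    [NormedSpace ℝ F] [FiniteDimensional ℝ F] {f : ℝ → F}
    (hf : ∀ T, 0 ≤ T → AbsolutelyContinuousOnInterval f 0 T) :
    ∀ᵐ t ∂(volume.restrict (Ici (0 : ℝ))), DifferentiableAt ℝ f t := by
  rw [ae_restrict_iff' measurableSet_Ici]
  have h : ∀ᵐ t : ℝ, ∀ n : ℕ, t ∈ uIcc (0 : ℝ) n → DifferentiableAt ℝ f t :=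
    ae_all_iff.2 fun n =>
      (hf n n.cast_nonneg).boundedVariationOn.ae_differentiableAt_of_mem_uIcc
  filter_upwards [h] with t ht ht0
  obtain ⟨n, hn⟩ := exists_nat_ge t
  exact ht n (by rw [uIcc_of_le n.cast_nonneg]; exact ⟨ht0, hn⟩)

theorem ae_restrict_Ici_mem_Ioi :
    ∀ᵐ t ∂(volume.restrict (Ici (0 : ℝ))), t ∈ Ioi (0 : ℝ) := by
  rw [← Measure.restrict_congr_set (Ioi_ae_eq_Ici (a := (0 : ℝ)))]
  exact ae_restrict_mem measurableSet_Ioi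

theorem absolutelyContinuousOnInterval_of_hasDerivWithinAt {F : Type*} [NormedAddCommGroup F]
    [NormedSpace ℝ F] {f f' : ℝ → F} (hf' : ContinuousOn f' (Ici 0))
    (hf : ∀ t ∈ Ici (0 : ℝ), HasDerivWithinAt f (f' t) (Ici 0) t) {T : ℝ} (hT : 0 ≤ T) :
    AbsolutelyContinuousOnInterval f 0 T := by
  obtain ⟨C, hC⟩ := isCompact_Icc.exists_bound_of_continuousOn
    (hf'.mono (Icc_subset_Ici_self : Icc 0 T ⊆ Ici 0))
  have hlip : LipschitzOnWith C.toNNReal f (Icc 0 T) :=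
    (convex_Icc 0 T).lipschitzOnWith_of_nnnorm_hasDerivWithin_le
      (fun t ht => (hf t ht.1).mono Icc_subset_Ici_self) fun t ht => by
        rw [← NNReal.coe_le_coe, coe_nnnorm]
        exact (hC t ht).trans (Real.le_coe_toNNReal C)
  rw [← uIcc_of_le hT] at hlip
  exact hlip.absolutelyContinuousOnInterval

variable {N p : ℕ} (G : SimpleGraph (Fin N)) [DecidableRel G.Adj]
  {Ω : Set (EuclideanSpace ℝ (Fin p))} {f : Fin N → EuclideanSpace ℝ (Fin p) → ℝ}

/-- Every initial value of the auxiliary states is the start of a trajectory. -/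
theorem exists_isTrajectory (hconv : Convex ℝ Ω) (hcomp : IsCompact Ω) (hne : Ω.Nonempty)
    {L : ℝ} (hL : 0 ≤ L)
    (hlip : ∀ i, ∀ x ∈ Ω, ∀ y ∈ Ω,
      ‖gradientWithin (f i) Ω x - gradientWithin (f i) Ω y‖ ≤ L * ‖x - y‖)
    (k₁ k₂ α β : ℝ) (η₀ : Fin N → EuclideanSpace ℝ (Fin p)) :
    ∃ η z s, IsTrajectory G Ω f k₁ k₂ α β η z s ∧ ∀ i, η i 0 = η₀ i := by
  choose P hP using exists_isProjection hcomp hne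
  have hPlip : ∀ x y, ‖P x - P y‖ ≤ ‖x - y‖ := fun x y => (hP x).norm_sub_le hconv (hP y)
  have hglip : ∀ i x y, ‖gradientWithin (f i) Ω (P x) - gradientWithin (f i) Ω (P y)‖ ≤
      L * ‖x - y‖ := fun i x y =>
    (hlip i _ (hP x).1 _ (hP y).1).trans (by gcongr; exact hPlip x y)
  let Pr : (PiLp 2 (fun _ : Fin N => EuclideanSpace ℝ (Fin p))) → (PiLp 2 (fun _ : Fin N => EuclideanSpace ℝ (Fin p))) := fun x => WithLp.toLp 2 fun i => P (x i)
  let Gr : (PiLp 2 (fun _ : Fin N => EuclideanSpace ℝ (Fin p))) → (PiLp 2 (fun _ : Fin N => EuclideanSpace ℝ (Fin p))) := fun x => WithLp.toLp 2 fun i => gradientWithin (f i) Ω (P (x i))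
  have hPr : LipschitzWith 1 Pr := .of_dist_le_mul fun x y => by
    rw [dist_eq_norm, dist_eq_norm]
    refine PiLp.norm_le_mul_norm zero_le_one fun i => ?_
    rw [NNReal.coe_one, one_mul]
    exact hPlip (x i) (y i)
  have hGr : LipschitzWith L.toNNReal Gr := .of_dist_le_mul fun x y => by
    rw [dist_eq_norm, dist_eq_norm, Real.coe_toNNReal _ hL]
    exact PiLp.norm_le_mul_norm hL fun i => hglip i (x i) (y i)
  let A : (PiLp 2 (fun _ : Fin N => EuclideanSpace ℝ (Fin p))) →L[ℝ] (PiLp 2 (fun _ : Fin N => EuclideanSpace ℝ (Fin p))) := diffusion G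
  -- The second component stands for `z` minus the gradient at the projected state. The term `d/dt
  -- ∇f_i(s_i)` drops out, and the initial value becomes zero.
  let v : (PiLp 2 (fun _ : Fin N => EuclideanSpace ℝ (Fin p))) × (PiLp 2 (fun _ : Fin N => EuclideanSpace ℝ (Fin p))) → (PiLp 2 (fun _ : Fin N => EuclideanSpace ℝ (Fin p))) × (PiLp 2 (fun _ : Fin N => EuclideanSpace ℝ (Fin p))) := fun y =>
    ((β * k₁) • A y.1 + β • Pr y.1 - β • y.1 - (β * α) • (y.2 + Gr y.1),
      (k₂ / β) • A (y.2 + Gr y.1))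
  obtain ⟨K, hv⟩ : ∃ K, LipschitzWith K v := by
    have h1 : LipschitzWith 1 (Prod.fst : (PiLp 2 (fun _ : Fin N => EuclideanSpace ℝ (Fin p))) × (PiLp 2 (fun _ : Fin N => EuclideanSpace ℝ (Fin p))) → (PiLp 2 (fun _ : Fin N => EuclideanSpace ℝ (Fin p)))) := LipschitzWith.prod_fst
    have h2 : LipschitzWith 1 (Prod.snd : (PiLp 2 (fun _ : Fin N => EuclideanSpace ℝ (Fin p))) × (PiLp 2 (fun _ : Fin N => EuclideanSpace ℝ (Fin p))) → (PiLp 2 (fun _ : Fin N => EuclideanSpace ℝ (Fin p)))) := LipschitzWith.prod_snd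
    have hs : ∀ c : ℝ, LipschitzWith ‖c‖₊ (fun y : (PiLp 2 (fun _ : Fin N => EuclideanSpace ℝ (Fin p))) => c • y) := lipschitzWith_smul
    have h3 := h2.add (hGr.comp h1)
    exact ⟨_, (((((hs (β * k₁)).comp (A.lipschitz.comp h1)).add ((hs β).comp (hPr.comp h1))).sub
      ((hs β).comp h1)).sub ((hs (β * α)).comp h3)).prodMk
      ((hs (k₂ / β)).comp (A.lipschitz.comp h3))⟩
  obtain ⟨γ, hγ0, hγ⟩ := hv.exists_solution
    (WithLp.toLp 2 η₀, (0 : (PiLp 2 (fun _ : Fin N => EuclideanSpace ℝ (Fin p)))))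
  let π1 (i : Fin N) : (PiLp 2 (fun _ : Fin N => EuclideanSpace ℝ (Fin p))) ×
      (PiLp 2 (fun _ : Fin N => EuclideanSpace ℝ (Fin p))) →L[ℝ] EuclideanSpace ℝ (Fin p) :=
    (PiLp.proj 2 (fun _ : Fin N => EuclideanSpace ℝ (Fin p)) i).comp
      (ContinuousLinearMap.fst ℝ _ _)
  let π2 (i : Fin N) : (PiLp 2 (fun _ : Fin N => EuclideanSpace ℝ (Fin p))) ×
      (PiLp 2 (fun _ : Fin N => EuclideanSpace ℝ (Fin p))) →L[ℝ] EuclideanSpace ℝ (Fin p) :=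
    (PiLp.proj 2 (fun _ : Fin N => EuclideanSpace ℝ (Fin p)) i).comp
      (ContinuousLinearMap.snd ℝ _ _)
  have hcont : ContinuousOn γ (Ici 0) := fun t ht => (hγ t ht).continuousWithinAt
  have hd1 : ∀ i, ∀ t ∈ Ici (0 : ℝ),
      HasDerivWithinAt (fun t => (γ t).1 i) ((v (γ t)).1 i) (Ici 0) t := fun i t ht =>
    (π1 i).hasFDerivAt.comp_hasDerivWithinAt t (hγ t ht)
  have hd2 : ∀ i, ∀ t ∈ Ici (0 : ℝ),
      HasDerivWithinAt (fun t => (γ t).2 i) ((v (γ t)).2 i) (Ici 0) t := fun i t ht =>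
    (π2 i).hasFDerivAt.comp_hasDerivWithinAt t (hγ t ht)
  have hvc : ContinuousOn (fun t => v (γ t)) (Ici 0) := hv.continuous.comp_continuousOn hcont
  have hac1 : ∀ i, ∀ T : ℝ, 0 ≤ T → AbsolutelyContinuousOnInterval (fun t => (γ t).1 i) 0 T :=
    fun i T hT => absolutelyContinuousOnInterval_of_hasDerivWithinAt
      ((π1 i).continuous.comp_continuousOn hvc) (hd1 i) hT
  have hac2 : ∀ i, ∀ T : ℝ, 0 ≤ T → AbsolutelyContinuousOnInterval (fun t => (γ t).2 i) 0 T :=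
    fun i T hT => absolutelyContinuousOnInterval_of_hasDerivWithinAt
      ((π2 i).continuous.comp_continuousOn hvc) (hd2 i) hT
  have hacg : ∀ i, ∀ T : ℝ, 0 ≤ T → AbsolutelyContinuousOnInterval
      (fun t => gradientWithin (f i) Ω (P ((γ t).1 i))) 0 T := fun i T hT =>
    (hac1 i T hT).of_dist_le (C := L) fun x _ y _ => by
      rw [dist_eq_norm, dist_eq_norm]
      exact hglip i _ _
  refine ⟨fun i t => (γ t).1 i, fun i t => (γ t).2 i + gradientWithin (f i) Ω (P ((γ t).1 i)),
    fun i t => P ((γ t).1 i), ⟨hac1, fun i T hT => (hac2 i T hT).fun_add (hacg i T hT),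
      fun i t _ => hP _, fun i => ?_, fun i => ?_, fun i => ?_⟩, fun i => by simp [hγ0]⟩
  · filter_upwards [ae_restrict_Ici_mem_Ioi] with t ht
    exact (hd1 i t (mem_Ici_of_Ioi ht)).hasDerivAt (Ici_mem_nhds ht)
  · filter_upwards [ae_restrict_Ici_mem_Ioi,
      ae_differentiableAt_of_absolutelyContinuousOnInterval (hacg i)] with t ht hg
    exact ⟨_, hg.hasDerivAt, ((hd2 i t (mem_Ici_of_Ioi ht)).hasDerivAt (Ici_mem_nhds ht)).add hg.hasDerivAt⟩
  · simp [hγ0]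

variable {G}

/-- Along a trajectory the average of the gradient trackers is the average of the gradients. -/
theorem IsTrajectory.sum_tracker_eq {L : ℝ} (hconv : Convex ℝ Ω)
    (hlip : ∀ i, ∀ x ∈ Ω, ∀ y ∈ Ω,
      ‖gradientWithin (f i) Ω x - gradientWithin (f i) Ω y‖ ≤ L * ‖x - y‖) (hL : 0 ≤ L)
    {k₁ k₂ α β : ℝ} {η z s : Fin N → ℝ → EuclideanSpace ℝ (Fin p)}
    (h : IsTrajectory G Ω f k₁ k₂ α β η z s) {t : ℝ} (ht : 0 ≤ t) :
    ∑ i, z i t = ∑ i, gradientWithin (f i) Ω (s i t) := by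
  have hacg : ∀ i, AbsolutelyContinuousOnInterval
      (fun τ => gradientWithin (f i) Ω (s i τ)) 0 t := fun i =>
    (h.ac_eta i t ht).of_dist_le (C := L) fun x hx y hy => by
      rw [uIcc_of_le ht] at hx hy
      have hx := h.proj i x hx.1
      have hy := h.proj i y hy.1
      rw [dist_eq_norm, dist_eq_norm]
      exact (hlip i _ hx.1 _ hy.1).trans (by gcongr; exact hx.norm_sub_le hconv hy)
  have hac : AbsolutelyContinuousOnInterval
      (fun τ => ∑ i, (z i τ - gradientWithin (f i) Ω (s i τ))) 0 t :=
    .fun_sum _ fun i _ => (h.ac_z i t ht).fun_sub (hacg i)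
  -- The gradient derivatives cancel and the diffusion terms sum to zero, so the difference keeps
  -- its initial value, which is zero.
  obtain ⟨C, hC⟩ := hac.const_of_ae_hasDerivAt_zero (by
    have h1 := (ae_restrict_iff' measurableSet_Ici).1 (ae_all_iff.2 h.ode_z)
    filter_upwards [h1] with τ hτ hmem
    rw [uIcc_of_le ht] at hmem
    choose q hq hz using hτ hmem.1
    have h2 := HasDerivAt.fun_sum (u := Finset.univ) fun i _ => (hz i).fun_sub (hq i)
    simpa only [add_sub_cancel_right, ← Finset.smul_sum, sum_diffusion_eq_zero, smul_zero]
      using h2)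
  have e0 := hC 0 left_mem_uIcc
  have et := hC t right_mem_uIcc
  rw [← e0] at et
  simpa [h.init, sub_eq_zero] using et

theorem IsTrajectory.norm_sub_le_mul_exp [NeZero N] {L σ c Λ : ℝ} (hconv : Convex ℝ Ω)
    (hmono : ∀ i, ∀ x ∈ Ω, ∀ y ∈ Ω, σ * ‖x - y‖ ^ 2 ≤
      inner ℝ (x - y) (gradientWithin (f i) Ω x - gradientWithin (f i) Ω y))
    (hlip : ∀ i, ∀ x ∈ Ω, ∀ y ∈ Ω,
      ‖gradientWithin (f i) Ω x - gradientWithin (f i) Ω y‖ ≤ L * ‖x - y‖)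
    {k₁ k₂ α β : ℝ}
    (hα : 0 < α) (hβ : 0 < β) (hβ1 : β ≤ 1) (hσ : 0 < σ) (hL : 0 < L) (hc : 0 < c) (hΛ : 0 ≤ Λ)
    (hαL : α * L ^ 2 ≤ σ) (hασ : α * σ ≤ 1)
    (hk₁ : 2 * α * L ^ 2 / σ ≤ k₁ * c)
    (hk₂ : 2 * (α + L * (k₁ * Λ + 2 + α * L)) ^ 2 / (α * σ) + α * L + α * σ / 8 ≤ k₂ * c)
    (hdiff : ∀ x : PiLp 2 (fun _ : Fin N => EuclideanSpace ℝ (Fin p)),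
      ⟪x, diffusion G x⟫ ≤ -(c * ‖x - consensusPart x‖ ^ 2))
    (hdiffn : ∀ x : PiLp 2 (fun _ : Fin N => EuclideanSpace ℝ (Fin p)),
      ‖diffusion G x‖ ≤ Λ * ‖x‖)
    {ystar : EuclideanSpace ℝ (Fin p)} (hy : ystar ∈ Ω)
    (hopt : ∀ v ∈ Ω, 0 ≤ ⟪∑ i, gradientWithin (f i) Ω ystar, v - ystar⟫)
    {η z s : Fin N → ℝ → EuclideanSpace ℝ (Fin p)}
    (h : IsTrajectory G Ω f k₁ k₂ α β η z s) :
    ∃ C : ℝ, ∀ i, ∀ t : ℝ, 0 ≤ t → ‖s i t - ystar‖ ≤ C * Real.exp (-(β * α * σ / 8) * t) := by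
  set zstar := (N : ℝ)⁻¹ • ∑ i, gradientWithin (f i) Ω ystar with hzstar
  set ηstar := ystar - α • zstar with hηstar
  have hproj : IsProjection Ω ηstar ystar := by
    rw [isProjection_iff_inner_le hconv]
    refine ⟨hy, fun w hw => ?_⟩
    have h1 : 0 ≤ α * ((N : ℝ)⁻¹ * ⟪∑ i, gradientWithin (f i) Ω ystar, w - ystar⟫) :=
      mul_nonneg hα.le (mul_nonneg (by positivity) (hopt w hw))
    rw [show ηstar - ystar = -(α • zstar) by rw [hηstar]; abel, inner_neg_left, inner_smul_left,
      hzstar, inner_smul_left]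
    simpa using h1
  let zbar : ℝ → EuclideanSpace ℝ (Fin p) := fun t => (N : ℝ)⁻¹ • ∑ j, z j t
  have hs : ∀ i t, 0 ≤ t → ‖s i t - ystar‖ ≤ ‖η i t - ηstar‖ := fun i t ht =>
    (h.proj i t ht).norm_sub_le hconv hproj
  let V : ℝ → ℝ := fun t => ∑ i, ‖η i t - ηstar‖ ^ 2 + ∑ i, ‖z i t - zbar t‖ ^ 2
  have hVac : ∀ T, 0 ≤ T → AbsolutelyContinuousOnInterval V 0 T := fun T hT =>
    (AbsolutelyContinuousOnInterval.fun_sum _ fun i _ =>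
      ((h.ac_eta i T hT).fun_sub (.const _ _ _)).norm_sq).fun_add
    (AbsolutelyContinuousOnInterval.fun_sum _ fun i _ =>
      ((h.ac_z i T hT).fun_sub
        ((AbsolutelyContinuousOnInterval.fun_sum _ fun j _ => h.ac_z j T hT).const_smul _)).norm_sq)
  have hV : ∀ᵐ t ∂(volume.restrict (Ici (0 : ℝ))),
      ∃ d, HasDerivAt V d t ∧ d ≤ -(β * α * σ / 4) * V t := by
    filter_upwards [ae_restrict_Ici_mem_Ioi, ae_all_iff.2 h.ode_eta, ae_all_iff.2 h.ode_z]
      with t ht heta hz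
    choose q hq hz using hz
    have ht0 : 0 ≤ t := ht.le
    let x : PiLp 2 (fun _ : Fin N => EuclideanSpace ℝ (Fin p)) := WithLp.toLp 2 fun i => η i t - ηstar
    let b : PiLp 2 (fun _ : Fin N => EuclideanSpace ℝ (Fin p)) := WithLp.toLp 2 fun i => z i t - zbar t
    let u : PiLp 2 (fun _ : Fin N => EuclideanSpace ℝ (Fin p)) := WithLp.toLp 2 fun i => s i t - ystar
    let m : PiLp 2 (fun _ : Fin N => EuclideanSpace ℝ (Fin p)) := WithLp.toLp 2 fun i =>
      gradientWithin (f i) Ω (s i t) - gradientWithin (f i) Ω ystar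
    let x' : PiLp 2 (fun _ : Fin N => EuclideanSpace ℝ (Fin p)) := WithLp.toLp 2 fun i => (β * k₁) • ∑ j, G.adjMatrix ℝ i j • (η j t - η i t)
        + β • s i t - β • η i t - (β * α) • z i t
    let Q : PiLp 2 (fun _ : Fin N => EuclideanSpace ℝ (Fin p)) := WithLp.toLp 2 q
    have hsum := h.sum_tracker_eq hconv hlip hL.le ht0
    -- Disagreements average to zero, so the Poincaré inequality controls all of `‖b‖`.
    have hbc : consensusPart b = 0 := by
      ext1 i
      have : (N : ℝ) ≠ 0 := by exact_mod_cast NeZero.ne N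
      simp [consensusPart, b, zbar, ← Nat.cast_smul_eq_nsmul ℝ, smul_smul, this]
    have hAb : ⟪b, diffusion G b⟫ ≤ -(c * ‖b‖ ^ 2) := by
      simpa [hbc] using hdiff b
    have hu : ‖u‖ ≤ ‖x‖ := by
      rw [← one_mul ‖x‖]
      refine PiLp.norm_le_mul_norm zero_le_one fun i => ?_
      rw [one_mul]
      exact hs i t ht0
    have hm : ‖m‖ ≤ L * ‖u‖ :=
      PiLp.norm_le_mul_norm hL.le fun i => hlip i _ (h.proj i t ht0).1 _ hy
    have hmon : σ * ‖u‖ ^ 2 ≤ ⟪u, m⟫ := by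
      rw [PiLp.norm_sq_eq_of_L2, PiLp.inner_apply, Finset.mul_sum]
      exact Finset.sum_le_sum fun i _ => hmono i _ (h.proj i t ht0).1 _ hy
    have hxn : ⟪x, consensusPart m⟫ = ⟪x, m⟫ - ⟪x - consensusPart x, m⟫ := by
      rw [inner_consensusPart, inner_sub_left]
      ring
    -- By conservation of the average, `b + consensusPart m` has components `z i t - zstar`; the
    -- constants cancel since `ystar - ηstar = α • zstar`.
    have hx' : x' = (β * k₁) • diffusion G x + β • u - β • x -
        (β * α) • (b + consensusPart m) := by
      ext1 i
      have h1 : zbar t = (N : ℝ)⁻¹ • ∑ j, gradientWithin (f j) Ω (s j t) := by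
        simp only [zbar, hsum]
      have h2 : (b + consensusPart m) i = z i t - zstar := by
        simp only [PiLp.add_apply, consensusPart, b, m, Fintype.card_fin, Finset.sum_sub_distrib,
          smul_sub, h1, hzstar]
        abel
      simp only [PiLp.sub_apply, PiLp.add_apply, PiLp.smul_apply, diffusion_apply] at h2 ⊢
      rw [h2]
      simp only [x', x, u, sub_sub_sub_cancel_right, hηstar]
      module
    have hQ : ‖Q‖ ≤ L * ‖x'‖ := by
      refine PiLp.norm_le_mul_norm hL.le fun i => ?_
      refine (heta i).norm_le_of_dist_le (hq i) ?_
      filter_upwards [Ioi_mem_nhds ht] with τ hτ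
      have h1 := h.proj i τ (le_of_lt hτ)
      have h2 := h.proj i t ht0
      exact (hlip i _ h1.1 _ h2.1).trans (by gcongr; exact h1.norm_sub_le hconv h2)
    have key := lyapunov_dissipation hα hβ hβ1 hσ hL hc hΛ hαL hασ hk₁ hk₂ (hdiff x) hAb
      (hdiffn x) hu hm hmon (norm_consensusPart_le m) hxn hx' hQ
    let z' : Fin N → EuclideanSpace ℝ (Fin p) := fun i =>
      (k₂ / β) • ∑ j, G.adjMatrix ℝ i j • (z j t - z i t) + q i
    have hzbar : HasDerivAt zbar ((N : ℝ)⁻¹ • ∑ j, z' j) t :=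
      (HasDerivAt.fun_sum fun j _ => hz j).fun_const_smul _
    have hVd : HasDerivAt V (∑ i, 2 * ⟪x i, x' i⟫ +
        ∑ i, 2 * ⟪b i, z' i - (N : ℝ)⁻¹ • ∑ j, z' j⟫) t :=
      (HasDerivAt.fun_sum fun i _ => ((heta i).sub_const ηstar).norm_sq).add
        (HasDerivAt.fun_sum fun i _ => ((hz i).sub hzbar).norm_sq)
    -- The drift of the mean is the same for all agents, hence orthogonal to `b`.
    have hbz : ∑ i, ⟪b i, (N : ℝ)⁻¹ • ∑ j, z' j⟫ = 0 := by
      have h1 := inner_consensusPart b (WithLp.toLp 2 z')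
      rw [hbc, inner_zero_left, PiLp.inner_apply] at h1
      simpa [consensusPart] using h1
    have hbz' : ∑ i, ⟪b i, z' i⟫ = ⟪b, (k₂ / β) • diffusion G b + Q⟫ := by
      rw [PiLp.inner_apply]
      refine Finset.sum_congr rfl fun i _ => ?_
      simp only [PiLp.add_apply, PiLp.smul_apply, diffusion_apply, b, z', Q,
        sub_sub_sub_cancel_right]
    refine ⟨_, hVd, ?_⟩
    have hVt : V t = ‖x‖ ^ 2 + ‖b‖ ^ 2 := by
      rw [PiLp.norm_sq_eq_of_L2, PiLp.norm_sq_eq_of_L2]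
    rw [hVt]
    refine le_trans (le_of_eq ?_) key
    rw [← hbz', PiLp.inner_apply]
    simp only [inner_sub_right, mul_sub, Finset.sum_sub_distrib, ← Finset.mul_sum, hbz]
    ring
  -- Taking square roots halves the decay rate of `V`.
  refine ⟨√(V 0), fun i t ht => ?_⟩
  have hdec := le_mul_exp_of_ae_hasDerivAt_le hVac hV ht
  have h1 : ‖η i t - ηstar‖ ^ 2 ≤ V t := by
    have := Finset.single_le_sum (f := fun i => ‖η i t - ηstar‖ ^ 2)
      (fun i _ => by positivity) (Finset.mem_univ i)
    have h2 : 0 ≤ ∑ i, ‖z i t - zbar t‖ ^ 2 := by positivity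
    simp only [V]
    linarith
  have hV0 : 0 ≤ V 0 := by positivity
  refine (hs i t ht).trans (le_of_sq_le_sq ?_ (by positivity))
  rw [mul_pow, Real.sq_sqrt hV0, ← Real.exp_nat_mul]
  refine (h1.trans hdec).trans (le_of_eq ?_)
  congr 2
  push_cast
  ring

end Trajectory

/-! ### Optimality condition and uniqueness of the minimizer -/

section Optimum

variable {N p : ℕ} {Ω : Set (EuclideanSpace ℝ (Fin p))}
  {f : Fin N → EuclideanSpace ℝ (Fin p) → ℝ}

theorem IsConstrainedMin.inner_sum_gradientWithin_nonneg (hconv : Convex ℝ Ω)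
    (hf : ∀ i, DifferentiableOn ℝ (f i) Ω) {y : EuclideanSpace ℝ (Fin p)}
    (h : IsConstrainedMin (fun y => ∑ i, f i y) Ω y) {v : EuclideanSpace ℝ (Fin p)}
    (hv : v ∈ Ω) : 0 ≤ ⟪∑ i, gradientWithin (f i) Ω y, v - y⟫ := by
  refine h.inner_gradientWithin_nonneg hconv ?_ hv
  rw [hasGradientWithinAt_iff_hasFDerivWithinAt, map_sum]
  exact HasFDerivWithinAt.fun_sum fun i _ =>
    ((hf i) y h.1).hasGradientWithinAt.hasFDerivWithinAt

/-- The first-order conditions at `x` and `y`, each tested at the other point, add up to an upper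
bound of zero in strong monotonicity. -/
theorem IsConstrainedMin.unique_of_strongly_monotone [NeZero N] (hconv : Convex ℝ Ω)
    (hf : ∀ i, DifferentiableOn ℝ (f i) Ω) {σ : ℝ} (hσ : 0 < σ)
    (hmono : ∀ i, ∀ x ∈ Ω, ∀ y ∈ Ω, σ * ‖x - y‖ ^ 2 ≤
      inner ℝ (x - y) (gradientWithin (f i) Ω x - gradientWithin (f i) Ω y))
    {x y : EuclideanSpace ℝ (Fin p)} (hx : IsConstrainedMin (fun y => ∑ i, f i y) Ω x)
    (hy : IsConstrainedMin (fun y => ∑ i, f i y) Ω y) : x = y := by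
  have h1 := hx.inner_sum_gradientWithin_nonneg hconv hf hy.1
  have h2 := hy.inner_sum_gradientWithin_nonneg hconv hf hx.1
  have h3 : ∑ _i : Fin N, σ * ‖x - y‖ ^ 2 ≤ ∑ i, inner ℝ (x - y)
      (gradientWithin (f i) Ω x - gradientWithin (f i) Ω y) :=
    Finset.sum_le_sum fun i _ => hmono i x hx.1 y hy.1
  rw [← inner_sum, Finset.sum_sub_distrib, inner_sub_right, real_inner_comm _ (x - y),
    real_inner_comm _ (x - y), Finset.sum_const, Finset.card_univ, Fintype.card_fin,
    nsmul_eq_mul] at h3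
  rw [← neg_sub x y, inner_neg_right] at h1
  have hN : (0 : ℝ) < N := by exact_mod_cast Nat.pos_of_ne_zero (NeZero.ne N)
  have h4 : ‖x - y‖ ^ 2 ≤ 0 := by
    by_contra! hpos
    have : 0 < N * (σ * ‖x - y‖ ^ 2) := by positivity
    linarith
  have h5 : ‖x - y‖ = 0 := by nlinarith [norm_nonneg (x - y)]
  exact sub_eq_zero.1 (norm_eq_zero.1 h5)

end Optimum

/-! ### Choice of the gains -/

theorem mainTheorem3 {N p : ℕ} (G : SimpleGraph (Fin N)) [DecidableRel G.Adj]
    (hG : G.Connected)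
    (Ω : Set (EuclideanSpace ℝ (Fin p)))
    (f : Fin N → EuclideanSpace ℝ (Fin p) → ℝ) (σ L : Fin N → ℝ)
    (hf : ∀ i, DifferentiableOn ℝ (f i) Ω)
    (hσ : ∀ i, 0 < σ i) (hL : ∀ i, 0 < L i)
    (hmono : ∀ i, ∀ x ∈ Ω, ∀ y ∈ Ω, σ i * ‖x - y‖ ^ 2 ≤
      inner ℝ (x - y) (gradientWithin (f i) Ω x - gradientWithin (f i) Ω y))
    (hlip : ∀ i, ∀ x ∈ Ω, ∀ y ∈ Ω,
      ‖gradientWithin (f i) Ω x - gradientWithin (f i) Ω y‖ ≤ L i * ‖x - y‖)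
    (hconv : Convex ℝ Ω) (hcomp : IsCompact Ω) (hint : (interior Ω).Nonempty)
    (hcurv : HasBoundedNormalCurvature Ω) :
    ∃ ystar : EuclideanSpace ℝ (Fin p),
      IsConstrainedMin (fun y => ∑ i, f i y) Ω ystar ∧
      (∀ y, IsConstrainedMin (fun y => ∑ i, f i y) Ω y → y = ystar) ∧
      ∃ α₀ > 0, ∀ α : ℝ, 0 < α → α ≤ α₀ →
      ∃ κ₁ > 0, ∀ k₁ : ℝ, κ₁ ≤ k₁ →
      ∃ κ₂ > 0, ∀ k₂ : ℝ, κ₂ ≤ k₂ →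
      ∀ β : ℝ, 0 < β → β ≤ 1 →
        (∀ η₀ : Fin N → EuclideanSpace ℝ (Fin p),
          ∃ η z s, IsTrajectory G Ω f k₁ k₂ α β η z s ∧ ∀ i, η i 0 = η₀ i) ∧
        ∃ γ > 0, ∀ η z s, IsTrajectory G Ω f k₁ k₂ α β η z s →
          ∃ C : ℝ, ∀ i, ∀ t : ℝ, 0 ≤ t → ‖s i t - ystar‖ ≤ C * Real.exp (-γ * t) := by
  have hNe : Nonempty (Fin N) := hG.nonempty
  have : NeZero N := ⟨(Fin.pos_iff_nonempty.2 hNe).ne'⟩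
  have hne : Ω.Nonempty := hint.mono interior_subset
  -- The smallest `σ i` and the largest `L i` serve all agents at once.
  obtain ⟨i₀, hi₀⟩ := Finite.exists_min σ
  obtain ⟨i₁, hi₁⟩ := Finite.exists_max L
  have hσ₀ := hσ i₀
  have hL₁ := hL i₁
  generalize σ i₀ = σ₀ at hi₀ hσ₀
  generalize L i₁ = L₁ at hi₁ hL₁
  have hmono' : ∀ i, ∀ x ∈ Ω, ∀ y ∈ Ω, σ₀ * ‖x - y‖ ^ 2 ≤
      inner ℝ (x - y) (gradientWithin (f i) Ω x - gradientWithin (f i) Ω y) :=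
    fun i x hx y hy => le_trans (by gcongr; exact hi₀ i) (hmono i x hx y hy)
  have hlip' : ∀ i, ∀ x ∈ Ω, ∀ y ∈ Ω,
      ‖gradientWithin (f i) Ω x - gradientWithin (f i) Ω y‖ ≤ L₁ * ‖x - y‖ :=
    fun i x hx y hy => (hlip i x hx y hy).trans (by gcongr; exact hi₁ i)
  obtain ⟨ystar, hystar, hmin⟩ := hcomp.exists_isMinOn hne
    (f := fun y => ∑ i, f i y) (continuousOn_finsetSum _ fun i _ => (hf i).continuousOn)
  have hymin : IsConstrainedMin (fun y => ∑ i, f i y) Ω ystar := ⟨hystar, fun v hv => hmin hv⟩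
  obtain ⟨c, hc, hdiff⟩ := hG.exists_inner_diffusion_le (F := EuclideanSpace ℝ (Fin p))
  have hdiffn := (diffusion (F := EuclideanSpace ℝ (Fin p)) G).le_opNorm
  have hΛ := norm_nonneg (diffusion (F := EuclideanSpace ℝ (Fin p)) G)
  generalize ‖diffusion (F := EuclideanSpace ℝ (Fin p)) G‖ = Λ at hdiffn hΛ
  refine ⟨ystar, hymin, fun y hy => hy.unique_of_strongly_monotone hconv hf hσ₀ hmono' hymin,
    -- The two entries encode `α * L₁ ^ 2 ≤ σ₀` and `α * σ₀ ≤ 1`, as the contraction of the gradient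
    -- step requires.
    min (σ₀ / L₁ ^ 2) (1 / σ₀), by positivity, fun α hα hα₀ => ?_⟩
  have hαL : α * L₁ ^ 2 ≤ σ₀ := (le_div_iff₀ (by positivity)).1 (hα₀.trans (min_le_left _ _))
  have hασ : α * σ₀ ≤ 1 := (le_div_iff₀ hσ₀).1 (hα₀.trans (min_le_right _ _))
  refine ⟨2 * α * L₁ ^ 2 / σ₀ / c, by positivity, fun k₁ hk₁ => ?_⟩
  have hk₁' := (div_le_iff₀ hc).1 hk₁
  -- The threshold grows with `k₁`, through the speed of the `η`-error, but does not involve `β`.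
  refine ⟨(2 * (α + L₁ * (k₁ * Λ + 2 + α * L₁)) ^ 2 / (α * σ₀) + α * L₁ + α * σ₀ / 8) / c,
    by positivity, fun k₂ hk₂ β hβ hβ1 => ?_⟩
  have hk₂' := (div_le_iff₀ hc).1 hk₂
  exact ⟨exists_isTrajectory G hconv hcomp hne hL₁.le hlip' k₁ k₂ α β,
    β * α * σ₀ / 8, by positivity, fun η z s h =>
      h.norm_sub_le_mul_exp hconv hmono' hlip' hα hβ hβ1 hσ₀ hL₁ hc hΛ hαL hασ hk₁' hk₂' hdiff
        hdiffn hystar fun v hv => hymin.inner_sum_gradientWithin_nonneg hconv hf hv⟩
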